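/- **Theorem (semantic security of MPHE encryption under RLWE).** Let $\kappa$ be the security parameter; all quantities below may depend on $\kappa$. Let $n$ be a power of two, $Q$ a product of at least one distinct primes, and $R_Q=\mathbb Z_Q[X]/(X^n+1)$; assume that $n$, $\log Q$ and the number of parties $N$ are polynomially bounded in $\kappa$. Let $\chi_{\rm key},\chi_{\rm enc},\chi_{\rm err}$ be probability distributions on $R_Q$. The scheme MPHE is the following. * *Setup.* A common reference polynomial $a\in R_Q$ is uniformly random. Independently, each party $i\in\{0,\dots,N-1\}$ draws $s_i\leftarrow\chi_{\rm key}$ and $e_i\leftarrow\chi_{\rm err}$; its secret key is $sk_i=s_i$ and its public key is $pk_i=(b_i,a)$ with $b_i=-(a s_i+e_i)$. The common public key is $\mathsf{cpk}=(\sum_i b_i,\,a)$. * *Encryption.* For a plaintext polynomial $m\in R_Q$ and $\mathsf{cpk}=(p_0,p_1)$: draw $u\leftarrow\chi_{\rm enc}$ and $e_0',e_1'\leftarrow\chi_{\rm err}$ and output $\mathsf{MPHE.Enc}(\mathsf{cpk},m)=(u p_0+e_0'+m,\ u p_1+e_1')$. For a coalition $S$ of parties let its view consist of $a$, $\mathsf{cpk}$,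 all $pk_i$, and $(s_i,e_i)$ for $i\in S$. An adversary is a (non-uniform) family of probabilistic Boolean circuits whose number of gates and random bits (and of bits of state passed between stages) is bounded by a polynomial in $\kappa$; ring elements are given to it by the binary expansions of their $n$ coefficients. Decision RLWE with $m$ samples, secret distribution $\chi$ and error distribution $\chi_{\rm err}$ is *hard* if every such family distinguishes $(a_i,a_i s+e_i)_{i\le m}$, with $s\leftarrow\chi$, $a_i$ uniform in $R_Q$ and $e_i\leftarrow\chi_{\rm err}$ independent, from $m$ independent uniform pairs in $R_Q^2$ with at most negligible advantage in $\kappa$. Assume that decision RLWE is hard for $\chi_{\rm key}$ with one sample and for $\chi_{\rm enc}$ with two samples. Let $S=S_\kappa$ be any coalition of at most $N-1$ parties. Then: 1. For any two messages $m_1,m_2\in R_Q$ (depending on $\kappa$ only): if $\beta\in\{1,2\}$ is uniformly random, every adversary which is given the view of $S$ and the ciphertext $\mathsf{MPHE.Enc}(\mathsf{cpk},m_\beta)$ guesses $\beta$ with a probability that differs from $1/2$ by at most a negligible function of $\kappa$. 2. The same holds if the adversary chooses $m_1,m_2$ itself after having seen the view of $S$ (IND-CPA security). -/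

import Mathlib

open scoped ENNReal

noncomputable section

namespace MPHE

/-! ### Polynomial growth, products of distributions -/

/-- `f` is bounded by a polynomial in the security parameter. -/
def PolyBounded (f : ℕ → ℕ) : Prop :=
  ∃ p : Polynomial ℕ, ∀ κ, f κ ≤ p.eval κ

/-- A function of the security parameter is negligible if it decays faster than every inverse
polynomial. -/
def Negligible (f : ℕ → ℝ) : Prop :=
  Asymptotics.SuperpolynomialDecay Filter.atTop (fun κ : ℕ => (κ : ℝ)) f

/-- Independent identically distributed samples, indexed by `ι`. -/
def iid {α : Type} [Fintype α] (ι : Type) [Fintype ι] (p : PMF α) : PMF (ι → α) := by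
  classical
  exact PMF.ofFintype (fun f => ∏ i, p (f i)) (by
    have h : ∑ a, p a = 1 := by rw [← tsum_fintype (L := .unconditional _)]; exact p.tsum_coe
    have h2 := Finset.prod_univ_sum (fun _ : ι => (Finset.univ : Finset α)) (fun _ a => p a)
    simp only [h, Finset.prod_const_one, Fintype.piFinset_univ] at h2
    exact h2.symm)

/-! ### The ring `R_Q = ℤ_Q[X] / (X ^ n + 1)` -/

/-- Ring parameters: the dimension is `2 ^ logDim`, the modulus is a product of (at least one)
distinct primes. -/
structure RingParams where
  logDim : ℕ
  primes : Finset ℕ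
  prime_of_mem : ∀ q ∈ primes, q.Prime
  nonempty : primes.Nonempty

namespace RingParams

variable (P : RingParams)

/-- The dimension, a power of two. -/
def dim : ℕ := 2 ^ P.logDim

/-- The ciphertext modulus. -/
def modulus : ℕ := ∏ q ∈ P.primes, q

/-- The bit length of the modulus. -/
def bitLen : ℕ := Nat.size P.modulus

instance modulus_neZero : NeZero P.modulus :=
  ⟨Finset.prod_ne_zero_iff.2 fun q hq => (P.prime_of_mem q hq).ne_zero⟩

/-- The polynomial `X ^ n + 1` over `ℤ_Q`. -/
def poly : Polynomial (ZMod P.modulus) := Polynomial.X ^ P.dim + Polynomial.C 1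

theorem poly_monic : P.poly.Monic :=
  Polynomial.monic_X_pow_add_C _ (pow_ne_zero _ two_ne_zero)

/-- The ring `R_Q = ℤ_Q[X] / (X ^ n + 1)`. -/
abbrev Rq : Type := AdjoinRoot P.poly

instance finite_Rq : Finite P.Rq :=
  haveI : Module.Finite (ZMod P.modulus) P.Rq := .of_basis (AdjoinRoot.powerBasis' P.poly_monic).basis
  Module.finite_of_finite (ZMod P.modulus)

instance fintype_Rq : Fintype P.Rq := Fintype.ofFinite _

/-- Bit positions of a ring element: `n` coefficients of `bitLen` bits each. -/
abbrev Pos : Type := Fin P.dim × Fin P.bitLen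

/-- Coefficient `j` of (the reduced representative of) a ring element. -/
def coeff (x : P.Rq) (j : ℕ) : ZMod P.modulus :=
  (AdjoinRoot.modByMonicHom P.poly_monic x).coeff j

/-- Binary encoding: every coefficient is written in binary as a number in `{0, …, Q - 1}`. -/
def encode (x : P.Rq) : P.Pos → Bool :=
  fun jk => (P.coeff x jk.1).val.testBit jk.2

/-- Decoding of a string of bits into a ring element (coefficients are reduced modulo `Q`). -/
def decode (b : P.Pos → Bool) : P.Rq :=
  AdjoinRoot.mk P.poly
    (∑ j, Polynomial.C (∑ k, if b (j, k) then (2 ^ (k : ℕ) : ZMod P.modulus) else 0) *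
      Polynomial.X ^ (j : ℕ))

/-- Binary encoding of a family of ring elements. -/
def encodeFam {I : Type} (x : I → P.Rq) : I × P.Pos → Bool :=
  fun ijk => P.encode (x ijk.1) ijk.2

end RingParams

/-! ### Boolean circuits -/

/-- A Boolean circuit with `s` gates on input wires `ι`, built gate by gate. A gate is a constant
or an arbitrary binary connective applied to two earlier wires. -/
inductive Gates (ι : Type) : ℕ → Type
  | nil : Gates ι 0
  | const {s : ℕ} (C : Gates ι s) (b : Bool) : Gates ι (s + 1)
  | op {s : ℕ} (C : Gates ι s) (g : Bool → Bool → Bool) (x y : ι ⊕ Fin s) : Gates ι (s + 1)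

/-- The values of all wires of a circuit on a given input. -/
def Gates.eval {ι : Type} (inp : ι → Bool) : {s : ℕ} → Gates ι s → ι ⊕ Fin s → Bool
  | _, .nil => Sum.elim inp Fin.elim0
  | _, .const C b => Sum.elim inp (Fin.snoc (fun i => C.eval inp (.inr i)) b)
  | _, .op C g x y =>
      Sum.elim inp (Fin.snoc (fun i => C.eval inp (.inr i)) (g (C.eval inp x) (C.eval inp y)))

/-- A probabilistic Boolean circuit with input bits `ι` and output bits `o`: in addition to its
input it reads `coins` independent uniformly random bits. -/
structure Circuit (ι o : Type) where
  coins : ℕ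
  size : ℕ
  gates : Gates (ι ⊕ Fin coins) size
  out : o → (ι ⊕ Fin coins) ⊕ Fin size

namespace Circuit

variable {ι o : Type}

/-- The cost of a circuit: number of gates plus number of random bits. -/
def cost (C : Circuit ι o) : ℕ := C.size + C.coins

/-- The output for given coins. -/
def eval (C : Circuit ι o) (inp : ι → Bool) (r : Fin C.coins → Bool) : o → Bool :=
  fun j => C.gates.eval (Sum.elim inp r) (C.out j)

/-- The output distribution. -/
def run (C : Circuit ι o) (inp : ι → Bool) : PMF (o → Bool) :=
  (PMF.uniformOfFintype (Fin C.coins → Bool)).map (C.eval inp)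

/-- The output distribution of a circuit with one output bit. -/
def runBit (C : Circuit ι Unit) (inp : ι → Bool) : PMF Bool :=
  (C.run inp).map fun f => f ()

end Circuit

/-! ### Decision ring learning with errors -/

section RLWE

variable (P : RingParams)

/-- Index set of the ring elements in `m` pairs `(a_i, b_i)`. -/
abbrev SampleIdx (m : ℕ) : Type := Fin m ⊕ Fin m

/-- `m` RLWE samples `(a_i, a_i * s + e_i)` under one secret `s`. -/
def rlweSamples (secret err : PMF P.Rq) (m : ℕ) : PMF (SampleIdx m → P.Rq) := do
  let s ← secret
  let a ← iid (Fin m) (PMF.uniformOfFintype P.Rq)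
  let e ← iid (Fin m) err
  return Sum.elim a fun i => a i * s + e i

/-- `m` uniformly random pairs. -/
def uniformSamples (m : ℕ) : PMF (SampleIdx m → P.Rq) :=
  iid (SampleIdx m) (PMF.uniformOfFintype P.Rq)

/-- Probability that a distinguisher outputs `1` on a tuple of ring elements drawn from `d`. -/
def acceptProb {I : Type} (D : Circuit (I × P.Pos) Unit) (d : PMF (I → P.Rq)) : ℝ :=
  ((do let x ← d; D.runBit (P.encodeFam x) : PMF Bool) true).toReal

end RLWE

/-- Hardness of decision RLWE with `m` samples: every family of polynomial-size probabilistic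
circuits has negligible advantage in distinguishing `m` RLWE samples from uniform. -/
def RLWEHard (P : ℕ → RingParams) (secret err : ∀ κ, PMF (P κ).Rq) (m : ℕ) : Prop :=
  ∀ D : ∀ κ, Circuit (SampleIdx m × (P κ).Pos) Unit,
    PolyBounded (fun κ => (D κ).cost) →
    Negligible fun κ =>
      |acceptProb (P κ) (D κ) (rlweSamples (P κ) (secret κ) (err κ) m) -
        acceptProb (P κ) (D κ) (uniformSamples (P κ) m)|

/-! ### The multiparty encryption scheme -/

/-- Parameters of the scheme: ring, number of parties, and the distributions (modulo `Q`) of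
secret keys, of the ephemeral secret used in encryption, and of errors. -/
structure Params extends RingParams where
  parties : ℕ
  keyDist : PMF toRingParams.Rq
  encDist : PMF toRingParams.Rq
  errDist : PMF toRingParams.Rq

namespace Params

variable (P : Params)

/-- One party's secret key and key-generation error `(s_i, e_i)`. -/
def keySecrets : PMF (P.Rq × P.Rq) := do
  let s ← P.keyDist
  let e ← P.errDist
  return (s, e)

/-- The public key `(-(a * s + e), a)` determined by the common reference polynomial `a` and a
party's secrets `(s, e)`. -/
def publicKey (a : P.Rq) (se : P.Rq × P.Rq) : P.Rq × P.Rq := (-(a * se.1 + se.2), a)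

/-- The collective public key: the first components are summed, the second component is the
common reference polynomial. -/
def collectiveKey (a : P.Rq) (pk : Fin P.parties → P.Rq × P.Rq) : P.Rq × P.Rq :=
  (∑ i, (pk i).1, a)

/-- Encryption of an encoded message under a public key. -/
def enc (cpk : P.Rq × P.Rq) (m : P.Rq) : PMF (P.Rq × P.Rq) := do
  let u ← P.encDist
  let e₀ ← P.errDist
  let e₁ ← P.errDist
  return (u * cpk.1 + e₀ + m, u * cpk.2 + e₁)

/-- The setup phase: the common reference polynomial is uniform, and every party draws its
secrets independently. -/
def setup : PMF (P.Rq × (Fin P.parties → P.Rq × P.Rq)) := do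
  let a ← PMF.uniformOfFintype P.Rq
  let se ← iid (Fin P.parties) P.keySecrets
  return (a, se)

/-- The public keys resulting from the setup phase. -/
def publicKeys (k : P.Rq × (Fin P.parties → P.Rq × P.Rq)) : Fin P.parties → P.Rq × P.Rq :=
  fun i => P.publicKey k.1 (k.2 i)

/-- The collective public key `cpk` resulting from the setup phase. -/
def cpk (k : P.Rq × (Fin P.parties → P.Rq × P.Rq)) : P.Rq × P.Rq :=
  P.collectiveKey k.1 (P.publicKeys k)

end Params

/-- The ring elements seen by a coalition `S` after the setup phase. -/
inductive ViewIdx {N : ℕ} (S : Finset (Fin N)) : Type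
  | crs
  | cpk
  | pk (i : Fin N)
  | sk (i : S)
  | err (i : S)

namespace Params

variable (P : Params)

/-- The view of a coalition `S` after the setup phase: the common reference polynomial, the
collective key, all public keys, and the secret keys and key-generation errors of the members of
`S`. (The second components of all public keys are the common reference polynomial.) -/
def view (S : Finset (Fin P.parties)) (k : P.Rq × (Fin P.parties → P.Rq × P.Rq)) :
    ViewIdx S → P.Rq
  | .crs => k.1
  | .cpk => (P.cpk k).1
  | .pk i => (P.publicKeys k i).1
  | .sk i => (k.2 i).1
  | .err i => (k.2 i).2

/-- The view of a coalition followed by a ciphertext. -/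
def viewWith (S : Finset (Fin P.parties)) (k : P.Rq × (Fin P.parties → P.Rq × P.Rq))
    (ct : P.Rq × P.Rq) : ViewIdx S ⊕ Fin 2 → P.Rq :=
  Sum.elim (P.view S k) ![ct.1, ct.2]

/-- The distinguishing game for two fixed messages: a uniform bit selects the message which is
encrypted under `cpk`; the adversary, given the view of `S` and the ciphertext, guesses the bit.
The game returns whether the guess is correct. -/
def fixedGame (S : Finset (Fin P.parties)) (m₁ m₂ : P.Rq)
    (A : Circuit ((ViewIdx S ⊕ Fin 2) × P.Pos) Unit) : PMF Bool := do
  let b ← PMF.uniformOfFintype Bool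
  let k ← P.setup
  let ct ← P.enc (P.cpk k) (if b then m₂ else m₁)
  let b' ← A.runBit (P.encodeFam (P.viewWith S k ct))
  return b' == b

/-- A chosen-plaintext adversary corrupting `S`: from the view of `S` the first circuit outputs
two messages and a state of `stateLen` bits; the second circuit gets the state, the view and the
challenge ciphertext, and outputs a guess. -/
structure Adversary (S : Finset (Fin P.parties)) where
  stateLen : ℕ
  choose : Circuit (ViewIdx S × P.Pos) ((Bool × P.Pos) ⊕ Fin stateLen)
  guess : Circuit (((ViewIdx S ⊕ Fin 2) × P.Pos) ⊕ Fin stateLen) Unit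

/-- The total cost of an adversary. -/
def Adversary.cost {P : Params} {S : Finset (Fin P.parties)} (A : P.Adversary S) : ℕ :=
  A.stateLen + A.choose.cost + A.guess.cost

/-- The chosen-plaintext game: as the distinguishing game, except that the adversary chooses the
two messages after having seen the view of `S`. -/
def cpaGame (S : Finset (Fin P.parties)) (A : P.Adversary S) : PMF Bool := do
  let b ← PMF.uniformOfFintype Bool
  let k ← P.setup
  let w ← A.choose.run (P.encodeFam (P.view S k))
  let m : P.Rq := P.decode fun p => w (.inl (b, p))
  let ct ← P.enc (P.cpk k) m
  let b' ← A.guess.runBit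
    (Sum.elim (P.encodeFam (P.viewWith S k ct)) fun i => w (.inr i))
  return b' == b

end Params

/-- The advantage over guessing in a game that returns whether the adversary won. -/
def advantage (game : PMF Bool) : ℝ := |(game true).toReal - 1 / 2|

end MPHE

end

/-! Fix an honest party `h ∉ S`, and fix the adversary's coins, which turns it into a deterministic
`Strategy`. Two hybrid steps then reduce the game to a blind guess. Key step
(`winProb_sub_hybridProb`): the view depends on the secrets of `h` only through `a * s + e`, so
one-sample RLWE for the key distribution replaces this element by a uniform `c`. The collective key
is a known shift of `-c`, so its first component `p₀` is then uniform and independent of `a`.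
Encryption step (`hybridProb_sub_half`): now `(p₀, a)` is a uniform pair and the two ciphertext
masks are RLWE samples under the secret `u`, so two-sample RLWE makes the masks uniform. A uniform
mask hides the message, and the guess is right with probability exactly 1/2 (`hybridProb_uniform`).
The reductions are non-uniform. An average is bounded by its largest term
(`abs_expect_le_of_forall`), so everything outside the RLWE challenge, including the bit and the
other parties' secrets, is hardwired. No distribution has to be sampled by a circuit. Moreover, with
these values fixed, the view and the masks are affine in the challenge, so no ring multiplication of
two inputs occurs: circuits for conditional addition of constants modulo `Q` suffice
(`derives_affine`). Circuit size is counted with `Derives`, where wires are replaced by the Boolean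
functions they carry. -/

noncomputable section

namespace MPHE

/-! ### Straight-line programs -/

/-- From the Boolean functions in `F`, all those in `G` can be computed with `k` gates. -/
inductive Derives {X : Type} : Set (X → Bool) → ℕ → Set (X → Bool) → Prop
  | done {F G : Set (X → Bool)} {k : ℕ} (h : G ⊆ F) : Derives F k G
  | const {F G : Set (X → Bool)} {k : ℕ} (b : Bool)
      (h : Derives (insert (fun _ => b) F) k G) : Derives F (k + 1) G
  | op {F G : Set (X → Bool)} {k : ℕ} (o : Bool → Bool → Bool) {f g : X → Bool}
      (hf : f ∈ F) (hg : g ∈ F)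
      (h : Derives (insert (fun x => o (f x) (g x)) F) k G) : Derives F (k + 1) G

namespace Derives

variable {X Y : Type} {F F' G G' : Set (X → Bool)} {k l : ℕ}

theorem weaken (h : Derives F k G) : ∀ {F' G' : Set (X → Bool)} {l : ℕ},
    F ⊆ F' → G' ⊆ G → k ≤ l → Derives F' l G' := by
  induction h with
  | done h => intro F' G' l hF hG _; exact .done (hG.trans (h.trans hF))
  | const b h ih =>
    intro F' G' l hF hG hl
    obtain ⟨l, rfl⟩ : ∃ l', l = l' + 1 := ⟨l - 1, by omega⟩
    exact .const b (ih (Set.insert_subset_insert hF) hG (by omega))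
  | op o hf hg h ih =>
    intro F' G' l hF hG hl
    obtain ⟨l, rfl⟩ : ∃ l', l = l' + 1 := ⟨l - 1, by omega⟩
    exact .op o (hF hf) (hF hg) (ih (Set.insert_subset_insert hF) hG (by omega))

theorem of_subset (h : Derives F k G) (hF : F ⊆ F') : Derives F' k G :=
  h.weaken hF subset_rfl le_rfl

theorem subset (h : Derives F k G) (hG : G' ⊆ G) : Derives F k G' :=
  h.weaken subset_rfl hG le_rfl

theorem mono (h : Derives F k G) (hl : k ≤ l) : Derives F l G :=
  h.weaken subset_rfl subset_rfl hl

/-- A derivation never discards a function, so the given functions remain available next to the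
derived ones. -/
theorem keep (h : Derives F k G) : Derives F k (F ∪ G) := by
  induction h with
  | done h => exact .done (Set.union_subset subset_rfl h)
  | const b h ih =>
    exact .const b (ih.subset (Set.union_subset_union_left _ (Set.subset_insert _ _)))
  | op o hf hg h ih =>
    exact .op o hf hg (ih.subset (Set.union_subset_union_left _ (Set.subset_insert _ _)))

theorem trans (h : Derives F k G) : ∀ {G' : Set (X → Bool)} {l : ℕ},
    Derives (F ∪ G) l G' → Derives F (k + l) G' := by
  induction h with
  | done h => intro G' l h'; exact h'.weaken (Set.union_subset subset_rfl h) subset_rfl (by omega)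
  | const b h ih =>
    intro G' l h'
    rw [Nat.add_right_comm]
    exact .const b (ih (h'.of_subset (Set.union_subset_union_left _ (Set.subset_insert _ _))))
  | op o hf hg h ih =>
    intro G' l h'
    rw [Nat.add_right_comm]
    exact .op o hf hg (ih (h'.of_subset (Set.union_subset_union_left _ (Set.subset_insert _ _))))

theorem union (h : Derives F k G) (h' : Derives F l G') : Derives F (k + l) (G ∪ G') :=
  h.trans ((h'.of_subset Set.subset_union_left).keep.subset
    (Set.union_subset_union_left _ Set.subset_union_right))

theorem iUnion_finset {J : Type} (s : Finset J) {G : J → Set (X → Bool)}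
    (h : ∀ j ∈ s, Derives F k (G j)) : Derives F (s.card * k) (⋃ j ∈ s, G j) := by
  classical
  induction s using Finset.induction_on with
  | empty => exact .done (by simp)
  | insert a s ha ih =>
    rw [Finset.card_insert_of_notMem ha, Finset.set_biUnion_insert, add_mul, one_mul, add_comm]
    exact (h a (Finset.mem_insert_self _ _)).union
      (ih fun j hj => h j (Finset.mem_insert_of_mem hj))

theorem iUnion {J : Type} [Fintype J] {G : J → Set (X → Bool)}
    (h : ∀ j, Derives F k (G j)) : Derives F (Fintype.card J * k) (⋃ j, G j) := by
  simpa using iUnion_finset (F := F) (k := k) (G := G) Finset.univ fun j _ => h j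

theorem range {J : Type} [Fintype J] {G : J → X → Bool}
    (h : ∀ j, Derives F k {G j}) : Derives F (Fintype.card J * k) (Set.range G) :=
  (iUnion h).subset (by simp)

theorem gate (o : Bool → Bool → Bool) {f g e : X → Bool} (hf : f ∈ F) (hg : g ∈ F)
    (he : ∀ x, e x = o (f x) (g x)) : Derives F 1 {e} :=
  .op o hf hg (.done (by simp [funext he]))

theorem consts : Derives F 2 (Set.range fun (b : Bool) (_ : X) => b) :=
  .const true (.const false (.done (by
    rintro _ ⟨b, rfl⟩
    cases b <;> simp)))

/-- Substitution of inputs. -/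
theorem comp (φ : Y → X) (h : Derives F k G) :
    Derives ((fun f y => f (φ y)) '' F) k ((fun f y => f (φ y)) '' G) := by
  induction h with
  | done h => exact .done (Set.image_mono h)
  | const b h ih => exact .const b (by simpa only [Set.image_insert_eq] using ih)
  | op o hf hg h ih =>
    exact .op o (Set.mem_image_of_mem _ hf) (Set.mem_image_of_mem _ hg)
      (by simpa only [Set.image_insert_eq] using ih)

end Derives

/-! ### Circuits and straight-line programs -/

/-- The functions computed by the wires of a circuit. -/
def Gates.funs {ι X : Type} (φ : X → ι → Bool) {s : ℕ} (C : Gates ι s) : Set (X → Bool) :=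
  Set.range fun w x => C.eval (φ x) w

theorem Gates.funs_const {ι X : Type} (φ : X → ι → Bool) {s : ℕ} (C : Gates ι s) (b : Bool) :
    (C.const b).funs φ = insert (fun _ => b) (C.funs φ) := by
  ext f
  simp only [Gates.funs, Set.mem_range, Set.mem_insert_iff]
  constructor
  · rintro ⟨i | i, rfl⟩
    · right; exact ⟨.inl i, by cases C <;> rfl⟩
    · induction i using Fin.lastCases with
      | last => left; funext x; simp [Gates.eval]
      | cast i => right; exact ⟨.inr i, by funext x; simp [Gates.eval]⟩
  · rintro (rfl | ⟨i | i, rfl⟩)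
    · exact ⟨.inr (Fin.last _), by funext x; simp [Gates.eval]⟩
    · exact ⟨.inl i, by cases C <;> rfl⟩
    · exact ⟨.inr i.castSucc, by funext x; simp [Gates.eval]⟩

theorem Gates.funs_op {ι X : Type} (φ : X → ι → Bool) {s : ℕ} (C : Gates ι s)
    (g : Bool → Bool → Bool) (u v : ι ⊕ Fin s) :
    (C.op g u v).funs φ =
      insert (fun x => g (C.eval (φ x) u) (C.eval (φ x) v)) (C.funs φ) := by
  ext f
  simp only [Gates.funs, Set.mem_range, Set.mem_insert_iff]
  constructor
  · rintro ⟨i | i, rfl⟩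
    · right; exact ⟨.inl i, by cases C <;> rfl⟩
    · induction i using Fin.lastCases with
      | last => left; funext x; simp [Gates.eval]
      | cast i => right; exact ⟨.inr i, by funext x; simp [Gates.eval]⟩
  · rintro (rfl | ⟨i | i, rfl⟩)
    · exact ⟨.inr (Fin.last _), by funext x; simp [Gates.eval]⟩
    · exact ⟨.inl i, by cases C <;> rfl⟩
    · exact ⟨.inr i.castSucc, by funext x; simp [Gates.eval]⟩

theorem Gates.derives {ι X : Type} (φ : X → ι → Bool) {s : ℕ} (C : Gates ι s) :
    Derives (Set.range fun i x => φ x i) s (C.funs φ) := by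
  induction C with
  | nil =>
    refine .done ?_
    rintro _ ⟨i | i, rfl⟩
    · exact ⟨i, rfl⟩
    · exact i.elim0
  | const C b ih =>
    rw [Gates.funs_const]
    exact ih.trans (.const b (.done (Set.insert_subset_insert Set.subset_union_right)))
  | op C g u v ih =>
    rw [Gates.funs_op]
    exact ih.trans (.op g (f := fun x => C.eval (φ x) u) (g := fun x => C.eval (φ x) v)
      (.inr ⟨u, rfl⟩) (.inr ⟨v, rfl⟩)
      (.done (Set.insert_subset_insert Set.subset_union_right)))

/-- Each derivation step becomes one appended gate, whose inputs are any wires carrying the required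
functions. Only the values on inputs of the form `φ x` matter, so behaviour on invalid encodings is
irrelevant. -/
theorem Derives.exists_gates {ι X : Type} (φ : X → ι → Bool) {F G : Set (X → Bool)} {k : ℕ}
    (h : Derives F k G) : ∀ {s : ℕ} (C : Gates ι s), F ⊆ C.funs φ →
      ∃ t, t ≤ s + k ∧ ∃ C' : Gates ι t, G ⊆ C'.funs φ := by
  induction h with
  | done h => intro s C hC; exact ⟨s, by omega, C, h.trans hC⟩
  | const b h ih =>
    intro s C hC
    obtain ⟨t, ht, C', h'⟩ := ih (C.const b)
      (by rw [Gates.funs_const]; exact Set.insert_subset_insert hC)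
    exact ⟨t, by omega, C', h'⟩
  | op o hf hg h ih =>
    intro s C hC
    obtain ⟨u, rfl⟩ := hC hf
    obtain ⟨v, rfl⟩ := hC hg
    obtain ⟨t, ht, C', h'⟩ := ih (C.op o u v)
      (by rw [Gates.funs_op]; exact Set.insert_subset_insert hC)
    exact ⟨t, by omega, C', h'⟩

/-- A derivable function is computed by a deterministic circuit. -/
theorem Derives.exists_circuit {ι X : Type} (φ : X → ι → Bool) {f : X → Bool} {k : ℕ}
    (h : Derives (Set.range fun i x => φ x i) k {f}) :
    ∃ D : Circuit ι Unit, D.cost ≤ k ∧ ∀ x, D.runBit (φ x) = PMF.pure (f x) := by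
  let ψ : X → (ι ⊕ Fin 0) → Bool := fun x => Sum.elim (φ x) Fin.elim0
  obtain ⟨t, ht, C, hC⟩ := h.exists_gates ψ .nil (by
    rintro _ ⟨i, rfl⟩
    exact ⟨.inl (.inl i), rfl⟩)
  obtain ⟨w, hw⟩ := hC (Set.mem_singleton f)
  refine ⟨⟨0, t, C, fun _ => w⟩, by simpa [Circuit.cost] using ht, fun x => ?_⟩
  have h0 : ∀ r, C.eval (Sum.elim (φ x) r) w = f x := fun r => by
    rw [← hw]
    congr! 2
  simp only [Circuit.runBit, Circuit.run, PMF.map_comp]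
  have : (fun f : Unit → Bool => f ()) ∘ (Circuit.eval ⟨0, t, C, fun _ => w⟩ (φ x)) =
      Function.const _ (f x) := by
    funext r
    exact h0 r
  rw [this, PMF.map_const]

/-- The functions computed by a probabilistic circuit with fixed coins. -/
theorem Circuit.derives {ι o X : Type} (C : Circuit ι o) (r : Fin C.coins → Bool)
    (φ : X → ι → Bool) :
    Derives (Set.range fun i x => φ x i) (2 + C.cost) (Set.range fun j x => C.eval (φ x) r j) := by
  -- The two extra gates are the constants `true` and `false`, which supply the fixed coins.
  refine (Derives.consts.trans (((C.gates.derives fun x => Sum.elim (φ x) r).of_subset ?_).subset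
    ?_)).mono (show 2 + C.size ≤ _ by simp [Circuit.cost])
  · rintro _ ⟨i | i, rfl⟩
    · exact .inl ⟨i, rfl⟩
    · exact .inr ⟨r i, rfl⟩
  · rintro _ ⟨j, rfl⟩
    exact ⟨C.out j, rfl⟩

/-! ### Modular arithmetic -/

section Arithmetic

variable {X : Type} {F : Set (X → Bool)}

/-- The `L` low bits of an integer-valued function. -/
def bits (L : ℕ) (ξ : X → ℕ) : Set (X → Bool) :=
  Set.range fun (i : Fin L) x => (ξ x).testBit i

theorem getLsbD_mem_of_bits_subset {L : ℕ} {ξ : X → ℕ} (h : bits L ξ ⊆ F) {i : ℕ} (hi : i < L) :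
    (fun x => (BitVec.ofNat L (ξ x)).getLsbD i) ∈ F := by
  refine h ⟨⟨i, hi⟩, ?_⟩
  funext x
  rw [BitVec.getLsbD_ofNat]
  simp [hi]

theorem derives_carry {L : ℕ} {ξ η : X → ℕ} (c : Bool) (hc : (fun _ => c) ∈ F)
    (hξ : bits L ξ ⊆ F) (hη : bits L η ⊆ F) {i : ℕ} (hi : i ≤ L) :
    Derives F (4 * i) ((fun j x =>
      BitVec.carry j (BitVec.ofNat L (ξ x)) (BitVec.ofNat L (η x)) c) '' Set.Iic i) := by
  induction i with
  | zero =>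
    refine .done ?_
    rintro _ ⟨j, hj, rfl⟩
    obtain rfl : j = 0 := by simpa using hj
    simpa using hc
  | succ i ih =>
    refine (ih (by omega)).trans (l := 4) ?_
    have hx := getLsbD_mem_of_bits_subset hξ (i := i) (by omega)
    have hy := getLsbD_mem_of_bits_subset hη (i := i) (by omega)
    -- The next carry is the majority of the two bits and the old carry, computed with four gates as
    -- `(x && y) || (carry && (x || y))`.
    refine .op (· && ·) (.inl hx) (.inl hy) ?_
    refine .op (· || ·) (.inr (.inl hx)) (.inr (.inl hy)) ?_
    refine .op (· && ·) (.inr (.inr (.inr ⟨i, by simp, rfl⟩))) (.inl rfl) ?_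
    refine .op (· || ·) (.inl rfl) (.inr (.inr (.inl rfl))) ?_
    refine .done ?_
    rintro _ ⟨j, hj, rfl⟩
    rcases Nat.lt_or_ge j (i + 1) with h | h
    · exact .inr (.inr (.inr (.inr (.inr ⟨j, Nat.lt_succ_iff.1 h, rfl⟩))))
    · obtain rfl : j = i + 1 := le_antisymm hj h
      left
      funext x
      simp only [BitVec.carry_succ, Bool.atLeastTwo]
      cases (BitVec.ofNat L (ξ x)).getLsbD i <;> cases (BitVec.ofNat L (η x)).getLsbD i <;>
        cases BitVec.carry i (BitVec.ofNat L (ξ x)) (BitVec.ofNat L (η x)) c <;> rfl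

/-- Ripple-carry addition: four gates for each carry and two XOR gates for each sum bit. -/
theorem derives_add {L : ℕ} {ξ η : X → ℕ} (hc : ∀ b, (fun _ => b) ∈ F)
    (hξ : bits L ξ ⊆ F) (hη : bits L η ⊆ F) :
    Derives F (6 * L) (bits L fun x => (ξ x + η x) % 2 ^ L) := by
  have h := derives_carry false (hc _) hξ hη le_rfl
  refine (h.trans (Derives.range (k := 2) fun i : Fin L => ?_)).mono (by simp; omega)
  have hx := getLsbD_mem_of_bits_subset hξ i.2
  have hy := getLsbD_mem_of_bits_subset hη i.2
  refine .op (· ^^ ·) (.inl hy) (.inr ⟨i, by simp, rfl⟩) ?_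
  refine .gate (· ^^ ·) (.inr (.inl hx)) (.inl rfl) fun x => ?_
  rw [← BitVec.getLsbD_add i.2, ← BitVec.ofNat_add, BitVec.getLsbD_ofNat]
  simp [Nat.testBit_mod_two_pow]

/-- Adding the bitwise complement of `t` to `ξ` with initial carry one produces a carry out of `L`
bits exactly when `t ≤ ξ`. -/
theorem derives_lt {L : ℕ} {ξ : X → ℕ} (hc : ∀ b, (fun _ => b) ∈ F)
    (hξ : bits L ξ ⊆ F) (hb : ∀ x, ξ x < 2 ^ L) {t : ℕ} (ht : t < 2 ^ L) :
    Derives F (4 * L + 1) {fun x => decide (ξ x < t)} := by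
  have h := derives_carry (η := fun _ => (~~~(BitVec.ofNat L t)).toNat) true (hc _) hξ
    (by rintro _ ⟨i, rfl⟩; exact hc _) le_rfl
  refine h.trans (Derives.gate (fun a _ => !a) (.inr ⟨L, by simp, rfl⟩) (.inl (hc true))
    fun x => ?_)
  simp only [BitVec.ofNat_toNat, BitVec.setWidth_eq]
  rw [← BitVec.ult_eq_not_carry]
  simp [BitVec.ult, Nat.mod_eq_of_lt (hb x), Nat.mod_eq_of_lt ht]

/-- Conditional addition of a constant modulo `Q`. -/
theorem derives_condAdd {Q L : ℕ} [NeZero Q] (hQ : Q < 2 ^ L) {ξ : X → ZMod Q} {β : X → Bool}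
    (hc : ∀ b, (fun _ => b) ∈ F) (hξ : bits L (fun x => (ξ x).val) ⊆ F) (hβ : β ∈ F)
    (v : ZMod Q) :
    Derives F (11 * L + 1) (bits L fun x => (ξ x + if β x then v else 0).val) := by
  have hv := v.val_lt
  have hlt := derives_lt hc hξ (fun x => (ξ x).val_lt.trans hQ) (t := Q - v.val) (by omega)
  -- The summand to be added modulo `2 ^ L`: it is `v` if no reduction modulo `Q` is needed, and `v
  -- - Q` (shifted by `2 ^ L`) otherwise. Each of its bits is a function of `β` and the comparison,
  -- hence a single gate. The total is `(4 * L + 1) + L + 6 * L`.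
  let y : Bool → Bool → ℕ := fun b c =>
    if b then (if c then v.val else 2 ^ L - Q + v.val) else 0
  let η : X → ℕ := fun x => y (β x) (decide ((ξ x).val < Q - v.val))
  refine (hlt.trans (l := L + 6 * L) (Derives.trans (G := bits L η) ?_ ?_)).mono (by omega)
  · refine (Derives.range (k := 1) fun i : Fin L => ?_).mono (by simp)
    exact .gate (fun b c => (y b c).testBit i) (.inl hβ) (.inr rfl) fun x => rfl
  · refine (derives_add (ξ := fun x => (ξ x).val) (η := η) (fun b => .inl (.inl (hc b)))
      (fun f hf => .inl (.inl (hξ hf))) Set.subset_union_right).subset (Eq.subset ?_)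
    congr 1
    funext x
    have hx := (ξ x).val_lt
    simp only [η, y]
    by_cases hb : β x
    · simp only [hb, if_true, ZMod.val_add]
      by_cases hl : (ξ x).val < Q - v.val
      · simp only [hl, decide_true, if_true]
        rw [Nat.mod_eq_of_lt (by omega), Nat.mod_eq_of_lt (by omega)]
      · simp only [hl, decide_false]
        rw [Nat.mod_eq_sub_mod (by omega), Nat.mod_eq_of_lt (by omega)]
        rw [show (ξ x).val + (if false = true then v.val else 2 ^ L - Q + v.val)
          = ((ξ x).val + v.val - Q) + 2 ^ L by simp; omega]
        rw [Nat.add_mod_right, Nat.mod_eq_of_lt (by omega)]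
    · simp [hb, Nat.mod_eq_of_lt (hx.trans hQ)]

theorem derives_affine_zmod {Q L : ℕ} [NeZero Q] (hQ : Q < 2 ^ L) {J : Type} (s : Finset J)
    {β : J → X → Bool} (hc : ∀ b, (fun _ => b) ∈ F) (hβ : ∀ j, β j ∈ F) (v₀ : ZMod Q)
    (v : J → ZMod Q) :
    Derives F (s.card * (11 * L + 1))
      (bits L fun x => (v₀ + ∑ j ∈ s, if β j x then v j else 0).val) := by
  classical
  induction s using Finset.induction_on with
  | empty => exact .done (by rintro _ ⟨i, rfl⟩; simpa using hc _)
  | insert a s ha ih =>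
    rw [Finset.card_insert_of_notMem ha, add_mul, one_mul]
    refine ih.trans ((derives_condAdd hQ (β := β a) (fun b => .inl (hc b))
      Set.subset_union_right (.inl (hβ a)) (v a)).subset (Eq.subset ?_))
    congr 1
    funext x
    rw [Finset.sum_insert ha]
    congr 1
    ring

end Arithmetic

/-! ### Affine functions with values in `R_Q` -/

namespace RingParams

variable (P : RingParams)

theorem modulus_lt : P.modulus < 2 ^ P.bitLen := Nat.lt_size_self _

theorem modulus_gt_one : 1 < P.modulus := by
  obtain ⟨q, hq⟩ := P.nonempty
  have h := (P.prime_of_mem q hq).one_lt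
  exact h.trans_le (Nat.le_of_dvd (Nat.pos_of_ne_zero P.modulus_neZero.ne)
    (Finset.dvd_prod_of_mem _ hq))

instance nontrivial_zmod : Nontrivial (ZMod P.modulus) :=
  haveI : Fact (1 < P.modulus) := ⟨P.modulus_gt_one⟩
  inferInstance

theorem natDegree_poly : P.poly.natDegree = P.dim :=
  Polynomial.natDegree_X_pow_add_C

/-- Coefficients as an additive map. -/
def coeffHom (j : ℕ) : P.Rq →+ ZMod P.modulus where
  toFun x := P.coeff x j
  map_zero' := by simp [coeff]
  map_add' x y := by simp [coeff]

/-- The value of a bit position. -/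
def weight (p : P.Pos) : P.Rq :=
  AdjoinRoot.mk P.poly (Polynomial.C (2 ^ (p.2 : ℕ)) * Polynomial.X ^ (p.1 : ℕ))

theorem decode_eq_sum (b : P.Pos → Bool) :
    P.decode b = ∑ p, if b p then P.weight p else 0 := by
  simp only [decode, Fintype.sum_prod_type, map_sum, Finset.sum_mul]
  refine Finset.sum_congr rfl fun j _ => Finset.sum_congr rfl fun k _ => ?_
  split_ifs <;> simp [weight]

theorem sum_testBit {n L : ℕ} (h : n < 2 ^ L) :
    ∑ k : Fin L, (if n.testBit k then 2 ^ (k : ℕ) else 0) = n := by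
  induction L generalizing n with
  | zero => simp at h ⊢; omega
  | succ L ih =>
    have h2 : n / 2 < 2 ^ L := by rw [pow_succ] at h; omega
    rw [Fin.sum_univ_succ]
    have := ih h2
    simp only [Fin.val_succ, Nat.testBit_succ, pow_succ, Fin.val_zero, pow_zero] at this ⊢
    have e : ∀ k : Fin L, (if (n / 2).testBit k then 2 ^ (k : ℕ) * 2 else 0)
        = (if (n / 2).testBit k then 2 ^ (k : ℕ) else 0) * 2 := by
      intro k; split_ifs <;> simp
    simp only [e]
    rw [← Finset.sum_mul, this, Nat.testBit_zero]
    rcases Nat.mod_two_eq_zero_or_one n with h | h <;> simp [h] <;> omega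

theorem decode_encode (x : P.Rq) : P.decode (P.encode x) = x := by
  have h1 : ∀ j : Fin P.dim, (∑ k : Fin P.bitLen,
      if P.encode x (j, k) then (2 ^ (k : ℕ) : ZMod P.modulus) else 0) = P.coeff x j := by
    intro j
    have := congrArg (Nat.cast : ℕ → ZMod P.modulus)
      (sum_testBit ((ZMod.val_lt (P.coeff x j)).trans P.modulus_lt))
    rw [ZMod.natCast_zmod_val] at this
    rw [← this]
    push_cast
    rfl
  simp only [decode, h1]
  have h2 : ∑ j : Fin P.dim, Polynomial.C (P.coeff x j) * Polynomial.X ^ (j : ℕ) =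
      AdjoinRoot.modByMonicHom P.poly_monic x := by
    rw [Fin.sum_univ_eq_sum_range
      (fun j => Polynomial.C (P.coeff x j) * (Polynomial.X : Polynomial (ZMod P.modulus)) ^ j)]
    symm
    refine Polynomial.as_sum_range_C_mul_X_pow' _ ?_
    obtain ⟨f, rfl⟩ := AdjoinRoot.mk_surjective x
    rw [AdjoinRoot.modByMonicHom_mk, ← P.natDegree_poly]
    refine Polynomial.natDegree_modByMonic_lt _ P.poly_monic fun h => ?_
    have := P.natDegree_poly
    rw [h, Polynomial.natDegree_one, dim] at this
    exact absurd this (by positivity)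
  rw [h2]
  exact AdjoinRoot.mk_leftInverse P.poly_monic x

variable {P} {X : Type} {F : Set (X → Bool)}

/-- The bits of a ring-valued function. -/
def rbits (φ : X → P.Rq) : Set (X → Bool) := Set.range fun p x => P.encode (φ x) p

variable (P) in
/-- Cost of an affine function of `t` bits. -/
def affineCost (t : ℕ) : ℕ := 2 + P.dim * (t * (11 * P.bitLen + 1))

/-- Taking a coefficient is additive, so each of the `P.dim` coefficients is an affine function of
the same bits over `ZMod P.modulus`. -/
theorem derives_affine {J : Type} [Fintype J] {β : J → X → Bool}
    (hβ : ∀ j, β j ∈ F) (v₀ : P.Rq) (v : J → P.Rq) :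
    Derives F (P.affineCost (Fintype.card J))
      (rbits fun x => v₀ + ∑ j, if β j x then v j else 0) := by
  refine Derives.consts.trans ?_
  have h := fun i : Fin P.dim => derives_affine_zmod P.modulus_lt Finset.univ (β := β)
    (F := F ∪ Set.range fun (b : Bool) (_ : X) => b)
    (fun b => .inr ⟨b, rfl⟩) (fun j => .inl (hβ j)) (P.coeffHom i v₀) (fun j => P.coeffHom i (v j))
  refine ((Derives.iUnion h).subset ?_).mono (by simp)
  rintro _ ⟨⟨i, k⟩, rfl⟩
  refine Set.mem_iUnion.2 ⟨i, k, ?_⟩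
  funext x
  have : P.coeff (v₀ + ∑ j, if β j x then v j else 0) i =
      P.coeffHom i v₀ + ∑ j, if β j x then P.coeffHom i (v j) else 0 := by
    change P.coeffHom i _ = _
    rw [map_add, map_sum]
    congr! 2 with j
    split_ifs <;> simp
  simp only [encode, this]

end RingParams

/-! ### Expectations over finite types -/

/-- The expectation of a real function. -/
def expect {α : Type} (p : PMF α) (f : α → ℝ) : ℝ := ∑' a, (p a).toReal * f a

section Expect

variable {α β ι : Type} [Fintype α] [Fintype β]

theorem expect_eq_sum (p : PMF α) (f : α → ℝ) : expect p f = ∑ a, (p a).toReal * f a :=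
  tsum_fintype _

theorem sum_toReal (p : PMF α) : ∑ a, (p a).toReal = 1 := by
  rw [← ENNReal.toReal_sum fun a _ => p.apply_ne_top a, ← tsum_fintype (L := .unconditional _),
    p.tsum_coe, ENNReal.toReal_one]

theorem expect_const (p : PMF α) (c : ℝ) : expect p (fun _ => c) = c := by
  rw [expect_eq_sum, ← Finset.sum_mul, sum_toReal, one_mul]

theorem expect_sub (p : PMF α) (f g : α → ℝ) :
    expect p (fun a => f a - g a) = expect p f - expect p g := by
  simp [expect_eq_sum, mul_sub]

theorem expect_pure (a : α) (f : α → ℝ) : expect (PMF.pure a) f = f a := by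
  classical
  rw [expect_eq_sum, Finset.sum_eq_single a]
  · simp
  · intro b _ hb; simp [PMF.pure_apply, hb]
  · simp

theorem expect_bind (p : PMF α) (q : α → PMF β) (f : β → ℝ) :
    expect (p.bind q) f = expect p fun a => expect (q a) f := by
  simp only [expect_eq_sum, PMF.bind_apply, tsum_fintype, Finset.mul_sum]
  rw [Finset.sum_comm]
  refine Finset.sum_congr rfl fun b _ => ?_
  rw [ENNReal.toReal_sum fun a _ => ENNReal.mul_ne_top (p.apply_ne_top a) ((q a).apply_ne_top b),
    Finset.sum_mul]
  simp [mul_assoc]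

theorem expect_map (p : PMF α) (g : α → β) (f : β → ℝ) :
    expect (p.map g) f = expect p fun a => f (g a) := by
  rw [← PMF.bind_pure_comp, expect_bind]
  simp [expect_pure]

theorem expect_comm (p : PMF α) (q : PMF β) (f : α → β → ℝ) :
    (expect p fun a => expect q (f a)) = expect q fun b => expect p fun a => f a b := by
  simp only [expect_eq_sum, Finset.mul_sum]
  rw [Finset.sum_comm]
  exact Finset.sum_congr rfl fun b _ => Finset.sum_congr rfl fun a _ => by ring

theorem expect_uniform_equiv [Nonempty α] (e : α ≃ α) (f : α → ℝ) :
    expect (PMF.uniformOfFintype α) (fun a => f (e a)) = expect (PMF.uniformOfFintype α) f := by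
  simp only [expect_eq_sum, PMF.uniformOfFintype_apply]
  exact e.sum_comp fun a => ((Fintype.card α : ℝ≥0∞)⁻¹).toReal * f a

theorem expect_uniform_bool (f : Bool → ℝ) :
    expect (PMF.uniformOfFintype Bool) f = (f true + f false) / 2 := by
  simp [expect_eq_sum]
  ring

theorem toReal_apply (p : PMF Bool) :
    (p true).toReal = expect p fun b => if b then 1 else 0 := by
  simp [expect_eq_sum]

/-- An expectation is dominated by one of the values. -/
theorem abs_expect_le_of_forall {T : Set ℝ} (p : PMF α) {f : α → ℝ}
    (h : ∀ a, ∃ t ∈ T, |f a| ≤ t) : ∃ t ∈ T, |expect p f| ≤ t := by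
  have : Nonempty α := p.support_nonempty.to_type
  obtain ⟨a, ha⟩ := Finite.exists_max fun a => |f a|
  obtain ⟨t, ht, hat⟩ := h a
  refine ⟨t, ht, le_trans ?_ hat⟩
  calc |expect p f| = |∑ b, (p b).toReal * f b| := by rw [expect_eq_sum]
    _ ≤ ∑ b, |(p b).toReal * f b| := Finset.abs_sum_le_sum_abs _ _
    _ ≤ ∑ b, (p b).toReal * |f a| := Finset.sum_le_sum fun b _ => by
        rw [abs_mul, abs_of_nonneg ENNReal.toReal_nonneg]
        exact mul_le_mul_of_nonneg_left (ha b) ENNReal.toReal_nonneg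
    _ = |f a| := by rw [← expect_eq_sum, expect_const]

theorem iid_apply [Fintype ι] (p : PMF α) (f : ι → α) : iid ι p f = ∏ i, p (f i) := rfl

theorem expect_iid [Fintype ι] [DecidableEq ι] (p : PMF α) (f : (ι → α) → ℝ) :
    expect (iid ι p) f = ∑ x : ι → α, (∏ i, (p (x i)).toReal) * f x := by
  simp only [expect_eq_sum, iid_apply, ENNReal.toReal_prod]

theorem expect_iid_equiv {κ : Type} [Fintype ι] [Fintype κ] (e : ι ≃ κ) (p : PMF α)
    (f : (ι → α) → ℝ) : expect (iid ι p) f = expect (iid κ p) fun x => f (x ∘ e) := by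
  classical
  rw [expect_iid, expect_iid, ← (Equiv.arrowCongr e (Equiv.refl α)).sum_comp]
  refine Finset.sum_congr rfl fun x _ => ?_
  congr 1
  · rw [← e.prod_comp]; simp [Equiv.arrowCongr]
  · congr 1; funext i; simp [Equiv.arrowCongr]

theorem expect_iid_sum {κ : Type} [Fintype ι] [Fintype κ] (p : PMF α)
    (f : (ι ⊕ κ → α) → ℝ) : expect (iid (ι ⊕ κ) p) f =
      expect (iid ι p) fun x => expect (iid κ p) fun y => f (Sum.elim x y) := by
  classical
  simp only [expect_iid]
  rw [← (Equiv.sumArrowEquivProdArrow ι κ α).symm.sum_comp, Fintype.sum_prod_type]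
  refine Finset.sum_congr rfl fun x _ => ?_
  rw [Finset.mul_sum]
  refine Finset.sum_congr rfl fun y _ => ?_
  simp [Fintype.prod_sum_type, Equiv.sumArrowEquivProdArrow, mul_assoc]

theorem expect_iid_unique [Unique ι] [Fintype ι] (p : PMF α) (f : (ι → α) → ℝ) :
    expect (iid ι p) f = expect p fun x => f fun _ => x := by
  classical
  rw [expect_iid, expect_eq_sum, ← (Equiv.funUnique ι α).symm.sum_comp]
  refine Finset.sum_congr rfl fun x _ => ?_
  rw [Fintype.prod_unique]
  rfl

theorem expect_iid_one (p : PMF α) (f : (Fin 1 → α) → ℝ) :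
    expect (iid (Fin 1) p) f = expect p fun x => f ![x] := by
  rw [expect_iid_unique]
  congr! with x
  simp

theorem expect_iid_two (p : PMF α) (f : (Fin 2 → α) → ℝ) :
    expect (iid (Fin 2) p) f = expect p fun x => expect p fun y => f ![x, y] := by
  rw [expect_iid_equiv (finSumFinEquiv (m := 1) (n := 1)).symm, expect_iid_sum]
  simp only [expect_iid_one]
  congr! 5 with x y
  funext i
  fin_cases i <;> rfl

/-- One coordinate of independent samples can be resampled. -/
theorem expect_iid_update [Fintype ι] [DecidableEq ι] (h : ι) (p : PMF α) (f : (ι → α) → ℝ) :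
    expect (iid ι p) f =
      expect (iid ι p) fun g => expect p fun x => f (Function.update g h x) := by
  classical
  -- Splits off the coordinate `h`, so that the product distribution factors.
  let e : Unit ⊕ {j // j ≠ h} ≃ ι :=
    { toFun := Sum.elim (fun _ => h) Subtype.val
      invFun := fun i => if hi : i = h then .inl () else .inr ⟨i, hi⟩
      left_inv := by rintro (_ | ⟨j, hj⟩) <;> simp [*]
      right_inv := fun i => by by_cases hi : i = h <;> simp [hi] }
  rw [expect_iid_equiv e.symm, expect_iid_equiv (ι := ι) e.symm, expect_iid_sum, expect_iid_sum]
  simp only [expect_iid_unique]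
  -- The left side gains a dummy average, matching the coordinate that is overwritten on the right.
  rw [← expect_const p (expect p _)]
  congr! 4 with x
  rw [expect_comm]
  congr! 4 with g y
  congr 1
  funext i
  by_cases hi : i = h
  · subst hi; simp [e]
  · simp [e, hi]

end Expect

/-! ### Deterministic strategies -/

/-- The real number `1` or `0`. -/
def ind (b : Bool) : ℝ := if b then 1 else 0

namespace RingParams

variable {P : RingParams} {I : Type}

variable (P) in
/-- The bits of a family of ring elements, as functions of the family. -/
def inputs (I : Type) : Set ((I → P.Rq) → Bool) := Set.range fun p x => P.encodeFam x p

variable (P) in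
/-- Affine functions of families of ring elements. -/
def IsAffine (φ : (I → P.Rq) → P.Rq) : Prop :=
  ∃ (v : P.Rq) (T : (I → P.Rq) →+ P.Rq), ∀ x, φ x = v + T x

namespace IsAffine

theorem const (v : P.Rq) : P.IsAffine fun _ : I → P.Rq => v := ⟨v, 0, by simp⟩

theorem proj (i : I) : P.IsAffine fun x : I → P.Rq => x i :=
  ⟨0, Pi.evalAddMonoidHom _ i, by simp⟩

variable {φ ψ : (I → P.Rq) → P.Rq}

theorem add (hφ : P.IsAffine φ) (hψ : P.IsAffine ψ) : P.IsAffine fun x => φ x + ψ x := by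
  obtain ⟨v, T, h⟩ := hφ
  obtain ⟨w, U, k⟩ := hψ
  exact ⟨v + w, T + U, fun x => by simp only [h, k, AddMonoidHom.add_apply]; abel⟩

theorem neg (hφ : P.IsAffine φ) : P.IsAffine fun x => -φ x := by
  obtain ⟨v, T, h⟩ := hφ
  exact ⟨-v, -T, fun x => by simp only [h, AddMonoidHom.neg_apply]; abel⟩

theorem sub (hφ : P.IsAffine φ) (hψ : P.IsAffine ψ) : P.IsAffine fun x => φ x - ψ x := by
  simpa only [sub_eq_add_neg] using hφ.add hψ.neg

theorem const_mul (c : P.Rq) (hφ : P.IsAffine φ) : P.IsAffine fun x => c * φ x := by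
  obtain ⟨v, T, h⟩ := hφ
  exact ⟨c * v, (AddMonoidHom.mulLeft c).comp T, fun x => by simp [h, mul_add]⟩

theorem mul_const (hφ : P.IsAffine φ) (c : P.Rq) : P.IsAffine fun x => φ x * c := by
  simpa only [mul_comm] using hφ.const_mul c

theorem sum {J : Type} (s : Finset J) {φ : J → (I → P.Rq) → P.Rq}
    (h : ∀ j, P.IsAffine (φ j)) : P.IsAffine fun x => ∑ j ∈ s, φ j x := by
  classical
  induction s using Finset.induction_on with
  | empty => simpa using const 0
  | insert a s ha ih => simpa only [Finset.sum_insert ha] using (h a).add ih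

/-- A ring element is the sum of the weights of its set bits, so an additive map is determined by
its values on single bits. Linearity over the ring is not needed. -/
theorem exists_eq_sum [Fintype I] (hφ : P.IsAffine φ) :
    ∃ (v₀ : P.Rq) (v : I × P.Pos → P.Rq),
      ∀ x, φ x = v₀ + ∑ p, if P.encodeFam x p then v p else 0 := by
  classical
  obtain ⟨v₀, T, h⟩ := hφ
  refine ⟨v₀, fun p => T (Pi.single p.1 (P.weight p.2)), fun x => ?_⟩
  rw [h]
  congr 1
  conv_lhs => rw [← Finset.univ_sum_single x]
  rw [map_sum, Fintype.sum_prod_type]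
  refine Finset.sum_congr rfl fun i _ => ?_
  change (T.comp (AddMonoidHom.single (fun _ : I => P.Rq) i)) (x i) = _
  conv_lhs => rw [← P.decode_encode (x i), decode_eq_sum, map_sum]
  refine Finset.sum_congr rfl fun p _ => ?_
  simp only [encodeFam]
  by_cases hp : P.encode (x i) p <;> simp [hp]

theorem derives [Fintype I] (hφ : P.IsAffine φ) {F : Set ((I → P.Rq) → Bool)}
    (hF : P.inputs I ⊆ F) : Derives F (P.affineCost (Fintype.card (I × P.Pos))) (rbits φ) := by
  obtain ⟨v₀, v, h⟩ := hφ.exists_eq_sum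
  rw [show φ = _ from funext h]
  exact derives_affine (fun p => hF ⟨p, rfl⟩) v₀ v

/-- Decoding is also a sum of weights, so the message bits merely act as further input bits of an
affine function. -/
theorem derives_add_decode [Fintype I] (hφ : P.IsAffine φ) {F : Set ((I → P.Rq) → Bool)}
    (hF : P.inputs I ⊆ F) {μ : (I → P.Rq) → P.Pos → Bool} (hμ : ∀ p, (fun x => μ x p) ∈ F) :
    Derives F (P.affineCost (Fintype.card ((I × P.Pos) ⊕ P.Pos)))
      (rbits fun x => φ x + P.decode (μ x)) := by
  obtain ⟨v₀, v, h⟩ := hφ.exists_eq_sum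
  have := derives_affine (F := F)
    (β := Sum.elim (fun p x => P.encodeFam x p) fun p x => μ x p)
    (by rintro (p | p); exacts [hF ⟨p, rfl⟩, hμ p]) v₀ (Sum.elim v P.weight)
  refine this.subset (Eq.subset ?_)
  congr 1
  funext x
  rw [h, decode_eq_sum, Fintype.sum_sum_type, add_assoc]
  rfl

end IsAffine

theorem affineCost_mono : Monotone P.affineCost := fun a b h => by
  unfold affineCost
  gcongr

end RingParams

open RingParams

variable {P : Params} {S : Finset (Fin P.parties)}

/-- A deterministic chosen-plaintext strategy: encodings of messages as a function of the view, and
a guess as a function of the view and the ciphertext. -/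
structure Strategy (S : Finset (Fin P.parties)) where
  msg : (ViewIdx S → P.Rq) → Bool → P.Pos → Bool
  guess : (ViewIdx S ⊕ Fin 2 → P.Rq) → Bool

namespace Strategy

variable (σ : Strategy S)

/-- The strategy is computed by straight-line programs of length `c`. -/
def CostLE (c : ℕ) : Prop :=
  Derives (P.inputs (ViewIdx S)) c (Set.range fun q v => σ.msg v (Prod.fst q) (Prod.snd q)) ∧
    Derives (P.inputs (ViewIdx S ⊕ Fin 2)) c {σ.guess}

/-- Whether the guess is correct, given the view, the bit, and a masking pair. -/
def win (view : ViewIdx S → P.Rq) (b : Bool) (c₀ c₁ : P.Rq) : Bool :=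
  σ.guess (Sum.elim view ![c₀ + P.decode (σ.msg view b), c₁]) == b

variable {σ}

/-- The view has `2 + P.parties + 2 * S.card` ring elements, each affine in the input. -/
theorem derives_view {I : Type} [Fintype I] {V : (I → P.Rq) → ViewIdx S → P.Rq}
    (hV : ∀ t, P.IsAffine fun x => V x t) :
    Derives (P.inputs I) ((2 + 3 * P.parties) * P.affineCost (Fintype.card (I × P.Pos)))
      (Set.range fun p x => P.encodeFam (V x) p) := by
  let e : Bool ⊕ Fin P.parties ⊕ S ⊕ S → ViewIdx S :=
    Sum.elim (fun b => if b then .crs else .cpk) (Sum.elim .pk (Sum.elim .sk .err))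
  have he : Function.Surjective e := by
    rintro (_ | _ | i | i | i)
    exacts [⟨.inl true, rfl⟩, ⟨.inl false, rfl⟩, ⟨.inr (.inl i), rfl⟩,
      ⟨.inr (.inr (.inl i)), rfl⟩, ⟨.inr (.inr (.inr i)), rfl⟩]
  refine ((Derives.iUnion fun j => (hV (e j)).derives subset_rfl).subset ?_).mono ?_
  · rintro _ ⟨⟨t, p⟩, rfl⟩
    obtain ⟨j, rfl⟩ := he t
    exact Set.mem_iUnion.2 ⟨j, p, rfl⟩
  · have := card_finset_fin_le S
    gcongr
    simp
    omega

variable (P) in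
/-- Cost of simulating a game for a strategy of cost `c`. -/
def simCost (c : ℕ) : ℕ :=
  (4 + 3 * P.parties) * P.affineCost (5 * (P.dim * P.bitLen)) + 2 * c + 2

/-- The simulator computes the view, runs the message program, adds the message to the first mask,
computes the second mask, runs the guess and compares with the hardwired `b`. The 5 in `simCost`
stands for at most four challenge elements plus one message. -/
theorem CostLE.derives_win {c : ℕ} (hσ : σ.CostLE c) {I : Type} [Fintype I]
    (hI : Fintype.card I ≤ 4) {V : (I → P.Rq) → ViewIdx S → P.Rq}
    (hV : ∀ t, P.IsAffine fun x => V x t) (b : Bool) {φ ψ : (I → P.Rq) → P.Rq}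
    (hφ : P.IsAffine φ) (hψ : P.IsAffine ψ) :
    Derives (P.inputs I) (simCost P c) {fun x => σ.win (V x) b (φ x) (ψ x)} := by
  have h1 := derives_view hV
  have h2 := hσ.1.comp V
  have h3 := hφ.derives_add_decode (F := P.inputs I ∪ (Set.range fun p x => P.encodeFam (V x) p) ∪
      (Set.range fun (q : Bool × P.Pos) x => σ.msg (V x) q.1 q.2))
    (Set.subset_union_left.trans Set.subset_union_left) (μ := fun x => σ.msg (V x) b)
    (fun p => .inr ⟨(b, p), rfl⟩)
  have h4 := hψ.derives subset_rfl
  have h5 := hσ.2.comp fun x => Sum.elim (V x) ![φ x + P.decode (σ.msg (V x) b), ψ x]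
  have c4 : Fintype.card (I × P.Pos) ≤ 4 * (P.dim * P.bitLen) := by
    simp only [Fintype.card_prod, Fintype.card_fin]
    gcongr
  have c1 : P.affineCost (Fintype.card (I × P.Pos)) ≤ P.affineCost (5 * (P.dim * P.bitLen)) :=
    affineCost_mono (c4.trans (by gcongr; omega))
  have c2 : P.affineCost (Fintype.card ((I × P.Pos) ⊕ P.Pos)) ≤
      P.affineCost (5 * (P.dim * P.bitLen)) := by
    refine affineCost_mono ?_
    rw [Fintype.card_sum]
    have : Fintype.card P.Pos = P.dim * P.bitLen := by simp
    omega
  have h12 : Derives (P.inputs I ∪ Set.range fun p x => P.encodeFam (V x) p) c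
      (Set.range fun (q : Bool × P.Pos) x => σ.msg (V x) q.1 q.2) := by
    refine h2.weaken ?_ ?_ le_rfl
    · rintro _ ⟨_, ⟨p, rfl⟩, rfl⟩
      exact .inr ⟨p, rfl⟩
    · rintro _ ⟨q, rfl⟩
      exact ⟨_, ⟨q, rfl⟩, rfl⟩
  refine (h1.trans (h12.trans (h3.trans ((h4.of_subset
    (Set.subset_union_left.trans (Set.subset_union_left.trans Set.subset_union_left))).trans
      ((h5.of_subset ?_).trans (l := 1) (.gate (fun g _ => g == b) (.inr ⟨_, rfl, rfl⟩)
        (.inr ⟨_, rfl, rfl⟩) fun x => rfl)))))).mono ?_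
  · rintro _ ⟨_, ⟨⟨t | t, p⟩, rfl⟩, rfl⟩
    · exact .inl (.inl (.inl (.inr ⟨(t, p), rfl⟩)))
    · fin_cases t
      · exact .inl (.inr ⟨p, rfl⟩)
      · exact .inr ⟨p, rfl⟩
  · have : (2 + 3 * P.parties) * P.affineCost (Fintype.card (I × P.Pos)) ≤
        (2 + 3 * P.parties) * P.affineCost (5 * (P.dim * P.bitLen)) := by gcongr
    have h : (4 + 3 * P.parties) * P.affineCost (5 * (P.dim * P.bitLen)) =
        (2 + 3 * P.parties) * P.affineCost (5 * (P.dim * P.bitLen)) +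
          2 * P.affineCost (5 * (P.dim * P.bitLen)) := by ring
    simp only [simCost]
    omega

end Strategy

/-! ### Distinguishing advantages -/

/-- The advantages of the distinguishers of cost at most `K` between two distributions. -/
def advantages (P : RingParams) {I : Type} (d d' : PMF (I → P.Rq)) (K : ℕ) : Set ℝ :=
  {t | ∃ D : Circuit (I × P.Pos) Unit, D.cost ≤ K ∧ t = |acceptProb P D d - acceptProb P D d'|}

theorem exists_mem_advantages {P : RingParams} {I : Type} [Fintype I] [DecidableEq I]
    (d d' : PMF (I → P.Rq)) {K : ℕ} {f : (I → P.Rq) → Bool} (h : Derives (P.inputs I) K {f}) :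
    ∃ t ∈ advantages P d d' K,
      |(expect d fun x => ind (f x)) - expect d' fun x => ind (f x)| ≤ t := by
  obtain ⟨D, hD, hf⟩ := h.exists_circuit (fun x => P.encodeFam x)
  have key : ∀ d : PMF (I → P.Rq), acceptProb P D d = expect d fun x => ind (f x) := by
    intro d
    rw [acceptProb, toReal_apply]
    refine (expect_bind _ _ _).trans ?_
    simp only [hf, expect_pure]
    rfl
  exact ⟨_, ⟨D, hD, rfl⟩, by rw [key, key]⟩

theorem expect_rlweSamples_one (P : RingParams) (secret err : PMF P.Rq)
    (f : (SampleIdx 1 → P.Rq) → ℝ) :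
    expect (rlweSamples P secret err 1) f =
      expect secret fun s => expect (PMF.uniformOfFintype P.Rq) fun a => expect err fun e =>
        f (Sum.elim ![a] ![a * s + e]) := by
  refine (expect_bind _ _ _).trans ?_
  congr! 2 with s
  refine (expect_bind _ _ _).trans ?_
  rw [expect_iid_one]
  congr! 2 with a
  refine (expect_bind _ _ _).trans ?_
  rw [expect_iid_one]
  congr! 2 with e
  refine (expect_pure _ _).trans ?_
  congr! 2
  funext i
  fin_cases i
  rfl

theorem expect_rlweSamples_two (P : RingParams) (secret err : PMF P.Rq)
    (f : (SampleIdx 2 → P.Rq) → ℝ) :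
    expect (rlweSamples P secret err 2) f =
      expect secret fun s => expect (iid (Fin 2) (PMF.uniformOfFintype P.Rq)) fun a =>
        expect (iid (Fin 2) err) fun e => f (Sum.elim a fun i => a i * s + e i) := by
  refine (expect_bind _ _ _).trans ?_
  congr! 2 with s
  refine (expect_bind _ _ _).trans ?_
  congr! 2 with a
  refine (expect_bind _ _ _).trans ?_
  congr! 2 with e
  exact expect_pure _ _

/-! ### The hybrid argument -/

namespace Strategy

variable (σ : Strategy S)

/-- The probability that a deterministic strategy wins. -/
def winProb : ℝ :=
  expect (PMF.uniformOfFintype Bool) fun b => expect P.setup fun k => expect P.encDist fun u =>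
    expect (iid (Fin 2) P.errDist) fun e =>
      ind (σ.win (P.view S k) b (u * (P.cpk k).1 + e 0) (u * (P.cpk k).2 + e 1))

/-- The first components of the public keys, where that of party `h` is `-c`. -/
def simKey (h : Fin P.parties) (g : Fin P.parties → P.Rq × P.Rq) (a c : P.Rq)
    (i : Fin P.parties) : P.Rq :=
  if i = h then -c else -(a * (g i).1 + (g i).2)

/-- The view of a coalition where the public key of party `h` is `(-c, a)`. -/
def simView (S : Finset (Fin P.parties)) (h : Fin P.parties) (g : Fin P.parties → P.Rq × P.Rq)
    (a c : P.Rq) : ViewIdx S → P.Rq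
  | .crs => a
  | .cpk => ∑ i, simKey h g a c i
  | .pk i => simKey h g a c i
  | .sk i => (g i).1
  | .err i => (g i).2

theorem publicKeys_update (h : Fin P.parties) (g : Fin P.parties → P.Rq × P.Rq)
    (a s e : P.Rq) (i : Fin P.parties) :
    (P.publicKeys (a, Function.update g h (s, e)) i).1 = simKey h g a (a * s + e) i := by
  by_cases hi : i = h
  · subst hi; simp [Params.publicKeys, Params.publicKey, simKey]
  · simp [Params.publicKeys, Params.publicKey, simKey, hi]

theorem cpk_update (h : Fin P.parties) (g : Fin P.parties → P.Rq × P.Rq) (a s e : P.Rq) :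
    (P.cpk (a, Function.update g h (s, e))).1 = ∑ i, simKey h g a (a * s + e) i := by
  simp only [← publicKeys_update]
  rfl

/-- This is where honesty of `h` enters: its secrets `s` and `e` reach the view only through its
public key. -/
theorem view_update {h : Fin P.parties} (hh : h ∉ S) (g : Fin P.parties → P.Rq × P.Rq)
    (a s e : P.Rq) :
    P.view S (a, Function.update g h (s, e)) = simView S h g a (a * s + e) := by
  have key : ∀ i : S, Function.update g h (s, e) i = g i := fun i =>
    Function.update_of_ne (fun h' : (i : Fin P.parties) = h => hh (h' ▸ i.2)) _ _
  funext t
  rcases t with _ | _ | i | i | i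
  · rfl
  · exact cpk_update h g a s e
  · exact publicKeys_update h g a s e i
  · simp only [Params.view, key, simView]
  · simp only [Params.view, key, simView]

theorem sum_simKey (h : Fin P.parties) (g : Fin P.parties → P.Rq × P.Rq) (a c : P.Rq) :
    ∑ i, simKey h g a c i = (∑ i, simKey h g a 0 i) - c := by
  rw [eq_sub_iff_add_eq, ← Finset.add_sum_erase _ _ (Finset.mem_univ h),
    ← Finset.add_sum_erase _ (simKey h g a 0) (Finset.mem_univ h)]
  have : ∀ i ∈ Finset.univ.erase h, simKey h g a c i = simKey h g a 0 i := fun i hi => by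
    simp [simKey, Finset.ne_of_mem_erase hi]
  rw [Finset.sum_congr rfl this, show simKey h g a c h = -c by simp [simKey],
    show simKey h g a 0 h = 0 by simp [simKey]]
  ring

section Affine

variable {I : Type} {α γ : (I → P.Rq) → P.Rq}

theorem isAffine_simKey (h : Fin P.parties) (g : Fin P.parties → P.Rq × P.Rq)
    (hα : P.IsAffine α) (hγ : P.IsAffine γ) (i : Fin P.parties) :
    P.IsAffine fun x => simKey h g (α x) (γ x) i := by
  unfold simKey
  split_ifs
  · exact hγ.neg
  · exact ((hα.mul_const _).add (.const _)).neg

/-- The products `a * (g i).1` have a constant factor once `g` is fixed. -/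
theorem isAffine_simView (h : Fin P.parties) (g : Fin P.parties → P.Rq × P.Rq)
    (hα : P.IsAffine α) (hγ : P.IsAffine γ) (t : ViewIdx S) :
    P.IsAffine fun x => simView S h g (α x) (γ x) t := by
  rcases t with _ | _ | i | i | i
  · exact hα
  · exact .sum _ fun i => isAffine_simKey h g hα hγ i
  · exact isAffine_simKey h g hα hγ i
  · exact .const _
  · exact .const _

end Affine

/-- The winning probability when the public key of party `h` is uniformly random. -/
def hybridProb (h : Fin P.parties) : ℝ :=
  expect (PMF.uniformOfFintype Bool) fun b => expect (iid _ P.keySecrets) fun g =>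
    expect P.encDist fun u => expect (iid (Fin 2) P.errDist) fun e =>
      expect (PMF.uniformOfFintype P.Rq) fun a => expect (PMF.uniformOfFintype P.Rq) fun c =>
        ind (σ.win (simView S h g a c) b (u * (∑ i, simKey h g a c i) + e 0) (u * a + e 1))

/-- The secrets of `h` are resampled and the independent draws reordered, so that the RLWE sample is
innermost and all outer variables can be fixed. -/
theorem winProb_eq {h : Fin P.parties} (hh : h ∉ S) : σ.winProb =
    expect (PMF.uniformOfFintype Bool) fun b => expect (iid _ P.keySecrets) fun g =>
      expect P.encDist fun u => expect (iid (Fin 2) P.errDist) fun e =>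
        expect P.keyDist fun s => expect (PMF.uniformOfFintype P.Rq) fun a =>
          expect P.errDist fun e' =>
            ind (σ.win (simView S h g a (a * s + e')) b
              (u * (∑ i, simKey h g a (a * s + e') i) + e 0) (u * a + e 1)) := by
  unfold winProb
  congr! 2 with b
  refine (expect_bind _ _ _).trans ?_
  have h1 : ∀ (a : P.Rq) (f : P.Rq × (Fin P.parties → P.Rq × P.Rq) → ℝ),
      expect (iid (Fin P.parties) P.keySecrets >>= fun se => return (a, se)) f =
        expect (iid _ P.keySecrets) fun g => expect P.keyDist fun s => expect P.errDist fun e =>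
          f (a, Function.update g h (s, e)) := by
    intro a f
    refine (expect_bind _ _ _).trans ?_
    rw [expect_iid_update h]
    congr! 2 with g
    refine (expect_bind _ _ _).trans ?_
    congr! 2 with s
    refine (expect_bind _ _ _).trans ?_
    congr! 2 with e
    exact (expect_pure _ _).trans (expect_pure _ _)
  simp only [h1]
  rw [expect_comm]
  congr! 2 with g
  have h3 : ∀ a s e, (P.cpk (a, Function.update g h (s, e))).2 = a := fun a s e => rfl
  simp only [view_update hh, cpk_update, h3]
  rw [expect_comm]
  simp only [expect_comm P.errDist P.encDist, expect_comm (PMF.uniformOfFintype P.Rq) P.encDist,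
    expect_comm P.keyDist P.encDist]
  congr! 2 with u
  simp only [expect_comm P.errDist (iid (Fin 2) P.errDist),
    expect_comm (PMF.uniformOfFintype P.Rq) (iid (Fin 2) P.errDist),
    expect_comm P.keyDist (iid (Fin 2) P.errDist)]

theorem CostLE.winProb_sub_hybridProb {σ : Strategy S} {c : ℕ} (hσ : σ.CostLE c)
    {h : Fin P.parties} (hh : h ∉ S) :
    ∃ t ∈ advantages P.toRingParams (rlweSamples P.toRingParams P.keyDist P.errDist 1)
      (uniformSamples P.toRingParams 1) (simCost P c), |σ.winProb - σ.hybridProb h| ≤ t := by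
  rw [σ.winProb_eq hh, hybridProb]
  simp only [← expect_sub]
  refine abs_expect_le_of_forall _ fun b => abs_expect_le_of_forall _ fun g =>
    abs_expect_le_of_forall _ fun u => abs_expect_le_of_forall _ fun e => ?_
  have hα := IsAffine.proj (P := P.toRingParams) (I := SampleIdx 1) (.inl 0)
  have hγ := IsAffine.proj (P := P.toRingParams) (I := SampleIdx 1) (.inr 0)
  have hV := isAffine_simView (S := S) h g hα hγ
  have hk := IsAffine.sum Finset.univ (isAffine_simKey h g hα hγ)
  have key := exists_mem_advantages (rlweSamples P.toRingParams P.keyDist P.errDist 1)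
    (uniformSamples P.toRingParams 1) (hσ.derives_win (by simp) hV b
      ((hk.const_mul u).add (.const (e 0))) ((hα.const_mul u).add (.const (e 1))))
  simpa only [expect_rlweSamples_one, uniformSamples, expect_iid_sum, expect_iid_one,
    Sum.elim_inl, Sum.elim_inr, Matrix.cons_val_zero, Matrix.cons_val_fin_one] using key

/-- Change of variables from the uniform `c` to the collective key: `x 0` is its first component and
`x 1` is `a`. The masks become RLWE samples under `u`. -/
theorem hybridProb_eq (h : Fin P.parties) : σ.hybridProb h =
    expect (PMF.uniformOfFintype Bool) fun b => expect (iid _ P.keySecrets) fun g =>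
      expect P.encDist fun u => expect (iid (Fin 2) (PMF.uniformOfFintype P.Rq)) fun x =>
        expect (iid (Fin 2) P.errDist) fun e =>
          ind (σ.win (simView S h g (x 1) ((∑ i, simKey h g (x 1) 0 i) - x 0)) b
            (x 0 * u + e 0) (x 1 * u + e 1)) := by
  unfold hybridProb
  congr! 6 with b g u
  rw [expect_comm (iid (Fin 2) (PMF.uniformOfFintype P.Rq))]
  congr! 2 with e
  rw [expect_iid_two, expect_comm]
  rw [expect_comm]
  conv_rhs => rw [expect_comm]
  congr! 2 with a
  -- By `sum_simKey`, the collective key and `c` determine each other by this reflection, which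
  -- preserves the uniform distribution.
  rw [← expect_uniform_equiv (Equiv.subLeft (∑ i, simKey h g a 0 i))]
  congr! 3 with p
  simp only [Equiv.subLeft_apply, sum_simKey h g a (_ - p), sub_sub_cancel, Matrix.cons_val_zero,
    Matrix.cons_val_one, mul_comm u]

/-- Translation by the message preserves the uniform mask, so the guess has the same distribution
for both values of `b`. Its probabilities of being `true` and `false` add up to one. -/
theorem hybridProb_uniform (h : Fin P.parties) :
    (expect (PMF.uniformOfFintype Bool) fun b => expect (iid _ P.keySecrets) fun g =>
      expect P.encDist fun _ => expect (uniformSamples P.toRingParams 2) fun x =>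
          ind (σ.win (simView S h g (x (.inl 1))
            ((∑ i, simKey h g (x (.inl 1)) 0 i) - x (.inl 0))) b
            (x (.inr 0)) (x (.inr 1)))) = 1 / 2 := by
  have h1 : ∀ (view : ViewIdx S → P.Rq) (b : Bool),
      (expect (iid (Fin 2) (PMF.uniformOfFintype P.Rq)) fun y =>
        ind (σ.win view b (y 0) (y 1))) =
      expect (iid (Fin 2) (PMF.uniformOfFintype P.Rq)) fun y =>
        ind (σ.guess (Sum.elim view ![y 0, y 1]) == b) := by
    intro view b
    simp only [expect_iid_two, Matrix.cons_val_zero, Matrix.cons_val_one]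
    exact expect_uniform_equiv (Equiv.addRight (P.decode (σ.msg view b))) fun z =>
      expect (PMF.uniformOfFintype P.Rq) fun w => ind (σ.guess (Sum.elim view ![z, w]) == b)
  have h2 : ∀ t : Bool, ind (t == false) = 1 - ind (t == true) := by
    intro t; cases t <;> simp [ind]
  simp only [uniformSamples, expect_iid_sum, Sum.elim_inl, Sum.elim_inr, h1,
    expect_uniform_bool, h2, expect_sub, expect_const]
  ring

/-- Only `b` and `g` are hardwired here; `u` and the encryption errors belong to the RLWE challenge.
The public key of `h` is recovered from the collective key by subtracting the other keys, which is
again affine. -/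
theorem CostLE.hybridProb_sub_half {σ : Strategy S} {c : ℕ} (hσ : σ.CostLE c)
    (h : Fin P.parties) :
    ∃ t ∈ advantages P.toRingParams (rlweSamples P.toRingParams P.encDist P.errDist 2)
      (uniformSamples P.toRingParams 2) (simCost P c), |σ.hybridProb h - 1 / 2| ≤ t := by
  rw [← σ.hybridProb_uniform h]
  have h1 : σ.hybridProb h =
      expect (PMF.uniformOfFintype Bool) fun b => expect (iid _ P.keySecrets) fun g =>
        expect (rlweSamples P.toRingParams P.encDist P.errDist 2) fun x =>
          ind (σ.win (simView S h g (x (.inl 1))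
            ((∑ i, simKey h g (x (.inl 1)) 0 i) - x (.inl 0))) b
            (x (.inr 0)) (x (.inr 1))) := by
    rw [hybridProb_eq]
    simp only [expect_rlweSamples_two, Sum.elim_inl, Sum.elim_inr]
  rw [h1]
  simp only [expect_const P.encDist, ← expect_sub]
  refine abs_expect_le_of_forall _ fun b => abs_expect_le_of_forall _ fun g => ?_
  have hp := IsAffine.proj (P := P.toRingParams) (I := SampleIdx 2) (.inl 0)
  have hα := IsAffine.proj (P := P.toRingParams) (I := SampleIdx 2) (.inl 1)
  have hγ := (IsAffine.sum Finset.univ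
    (isAffine_simKey h g hα (.const 0))).sub hp
  exact exists_mem_advantages _ _ (hσ.derives_win (by simp)
    (isAffine_simView (S := S) h g hα hγ) b (.proj (Sum.inr 0))
    (.proj (Sum.inr 1)))

end Strategy

theorem Strategy.CostLE.winProb_sub_half {σ : Strategy S} {c : ℕ} (hσ : σ.CostLE c)
    (hS : S.card < P.parties) :
    ∃ t ∈ advantages P.toRingParams (rlweSamples P.toRingParams P.keyDist P.errDist 1)
        (uniformSamples P.toRingParams 1) (simCost P c),
      ∃ t' ∈ advantages P.toRingParams (rlweSamples P.toRingParams P.encDist P.errDist 2)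
        (uniformSamples P.toRingParams 2) (simCost P c), |σ.winProb - 1 / 2| ≤ t + t' := by
  obtain ⟨h, hh⟩ : ∃ h, h ∉ S := by
    by_contra! hall
    rw [(Finset.eq_univ_iff_forall.2 hall), Finset.card_univ, Fintype.card_fin] at hS
    exact hS.false
  obtain ⟨t, ht, h1⟩ := hσ.winProb_sub_hybridProb hh
  obtain ⟨t', ht', h2⟩ := hσ.hybridProb_sub_half h
  exact ⟨t, ht, t', ht', (abs_sub_le _ (σ.hybridProb h) _).trans (add_le_add h1 h2)⟩

/-! ### From adversaries to deterministic strategies -/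

/-- The strategy which encrypts fixed messages and guesses with fixed coins. -/
def fixedStrategy (m₁ m₂ : P.Rq) (A : Circuit ((ViewIdx S ⊕ Fin 2) × P.Pos) Unit)
    (r : Fin A.coins → Bool) : Strategy S where
  msg _ b := P.encode (if b then m₂ else m₁)
  guess v := A.eval (P.encodeFam v) r ()

theorem fixedStrategy_costLE (m₁ m₂ : P.Rq) (A : Circuit ((ViewIdx S ⊕ Fin 2) × P.Pos) Unit)
    (r : Fin A.coins → Bool) : (fixedStrategy m₁ m₂ A r).CostLE (4 + A.cost) := by
  constructor
  · refine Derives.consts.weaken subset_rfl ?_ (by omega)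
    rintro _ ⟨q, rfl⟩
    exact ⟨_, rfl⟩
  · refine (A.derives r fun v => P.encodeFam v).weaken subset_rfl ?_ (by omega)
    rintro _ rfl
    exact ⟨(), rfl⟩

/-- The strategy of a chosen-plaintext adversary with fixed coins. -/
def Params.Adversary.strategy (A : P.Adversary S) (r₁ : Fin A.choose.coins → Bool)
    (r₂ : Fin A.guess.coins → Bool) : Strategy S where
  msg v b p := A.choose.eval (P.encodeFam v) r₁ (.inl (b, p))
  guess v := A.guess.eval (Sum.elim (P.encodeFam v) fun i =>
    A.choose.eval (P.encodeFam fun t => v (.inl t)) r₁ (.inr i)) r₂ ()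

/-- The guess of a strategy receives no state; it recomputes the state by running `choose` again
with the same coins. Each of the two circuits needs two constant gates for its coins, whence the 4.
-/
theorem Params.Adversary.strategy_costLE (A : P.Adversary S) (r₁ : Fin A.choose.coins → Bool)
    (r₂ : Fin A.guess.coins → Bool) : (A.strategy r₁ r₂).CostLE (4 + A.cost) := by
  constructor
  · refine (A.choose.derives r₁ fun v => P.encodeFam v).weaken subset_rfl ?_
      (by simp only [Params.Adversary.cost]; omega)
    rintro _ ⟨q, rfl⟩
    exact ⟨.inl q, rfl⟩
  · have h1 := A.choose.derives r₁ fun v : ViewIdx S ⊕ Fin 2 → P.Rq =>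
      P.encodeFam fun t => v (.inl t)
    have h2 := A.guess.derives r₂ fun v : ViewIdx S ⊕ Fin 2 → P.Rq =>
      Sum.elim (P.encodeFam v) fun i =>
        A.choose.eval (P.encodeFam fun t => v (.inl t)) r₁ (.inr i)
    refine ((h1.of_subset (F' := P.inputs _) ?_).trans (h2.weaken (l := 2 + A.guess.cost)
      ?_ ?_ le_rfl)).mono (by simp only [Params.Adversary.cost]; omega)
    · rintro _ ⟨⟨t, p⟩, rfl⟩
      exact ⟨(.inl t, p), rfl⟩
    · rintro _ ⟨p | i, rfl⟩
      · exact .inl ⟨p, rfl⟩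
      · exact .inr ⟨.inr i, rfl⟩
    · rintro _ rfl
      exact ⟨(), rfl⟩

theorem expect_enc (cpk : P.Rq × P.Rq) (m : P.Rq) (f : P.Rq × P.Rq → ℝ) :
    expect (P.enc cpk m) f = expect P.encDist fun u => expect (iid (Fin 2) P.errDist) fun e =>
      f (u * cpk.1 + e 0 + m, u * cpk.2 + e 1) := by
  refine (expect_bind _ _ _).trans ?_
  congr! 2 with u
  rw [expect_iid_two]
  refine (expect_bind _ _ _).trans ?_
  congr! 2 with e₀
  refine (expect_bind _ _ _).trans ?_
  congr! 2 with e₁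
  exact expect_pure _ _

theorem expect_runBit {ι : Type} (A : Circuit ι Unit) (inp : ι → Bool) (f : Bool → ℝ) :
    expect (A.runBit inp) f =
      expect (PMF.uniformOfFintype (Fin A.coins → Bool)) fun r => f (A.eval inp r ()) := by
  rw [Circuit.runBit, expect_map, Circuit.run, expect_map]

/-- The adversary's coins are independent of the rest of the game and may be drawn first. -/
theorem fixedGame_toReal (m₁ m₂ : P.Rq) (A : Circuit ((ViewIdx S ⊕ Fin 2) × P.Pos) Unit) :
    (P.fixedGame S m₁ m₂ A true).toReal =
      expect (PMF.uniformOfFintype (Fin A.coins → Bool)) fun r =>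
        (fixedStrategy m₁ m₂ A r).winProb := by
  rw [toReal_apply]
  simp only [Strategy.winProb]
  refine (expect_bind _ _ _).trans ?_
  rw [expect_comm]
  congr! 2 with b
  refine (expect_bind _ _ _).trans ?_
  rw [expect_comm]
  congr! 2 with k
  refine (expect_bind _ _ _).trans ?_
  rw [expect_enc, expect_comm (PMF.uniformOfFintype (Fin A.coins → Bool))]
  congr! 2 with u
  rw [expect_comm (PMF.uniformOfFintype (Fin A.coins → Bool))]
  congr! 2 with e
  refine (expect_bind (A.runBit _) _ _).trans ?_
  rw [expect_runBit]
  congr! 2 with r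
  refine (expect_pure _ _).trans ?_
  simp only [Strategy.win, fixedStrategy, P.decode_encode]
  rfl

theorem cpaGame_toReal (A : P.Adversary S) :
    (P.cpaGame S A true).toReal =
      expect (PMF.uniformOfFintype (Fin A.choose.coins → Bool)) fun r₁ =>
        expect (PMF.uniformOfFintype (Fin A.guess.coins → Bool)) fun r₂ =>
          (A.strategy r₁ r₂).winProb := by
  rw [toReal_apply]
  simp only [Strategy.winProb]
  refine (expect_bind _ _ _).trans ?_
  simp only [expect_comm _ (PMF.uniformOfFintype Bool)]
  congr! 2 with b
  refine (expect_bind _ _ _).trans ?_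
  simp only [expect_comm _ P.setup]
  congr! 2 with k
  refine (expect_bind _ _ _).trans ?_
  rw [Circuit.run, expect_map]
  congr! 2 with r₁
  refine (expect_bind _ _ _).trans ?_
  rw [expect_enc, expect_comm (PMF.uniformOfFintype (Fin A.guess.coins → Bool))]
  congr! 2 with u
  rw [expect_comm (PMF.uniformOfFintype (Fin A.guess.coins → Bool))]
  congr! 2 with e
  refine (expect_bind (A.guess.runBit _) _ _).trans ?_
  rw [expect_runBit]
  congr! 2 with r₂
  exact expect_pure _ _

theorem expect_sub_half {α : Type} [Fintype α] (p : PMF α) (f : α → ℝ) :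
    expect p f - 1 / 2 = expect p fun a => f a - 1 / 2 := by
  rw [expect_sub, expect_const]

/-- The bounds for games against adversaries of cost `c`. -/
def gameBounds (P : Params) (c : ℕ) : Set ℝ :=
  {x | ∃ t ∈ advantages P.toRingParams (rlweSamples P.toRingParams P.keyDist P.errDist 1)
        (uniformSamples P.toRingParams 1) (Strategy.simCost P (4 + c)),
      ∃ t' ∈ advantages P.toRingParams (rlweSamples P.toRingParams P.encDist P.errDist 2)
        (uniformSamples P.toRingParams 2) (Strategy.simCost P (4 + c)), x = t + t'}

theorem Strategy.CostLE.exists_gameBounds {σ : Strategy S} {c : ℕ} (hσ : σ.CostLE (4 + c))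
    (hS : S.card < P.parties) : ∃ x ∈ gameBounds P c, |σ.winProb - 1 / 2| ≤ x := by
  obtain ⟨t, ht, t', ht', h⟩ := hσ.winProb_sub_half hS
  exact ⟨_, ⟨t, ht, t', ht', rfl⟩, h⟩

theorem advantage_fixedGame_le (hS : S.card < P.parties) (m₁ m₂ : P.Rq)
    (A : Circuit ((ViewIdx S ⊕ Fin 2) × P.Pos) Unit) :
    ∃ x ∈ gameBounds P A.cost, advantage (P.fixedGame S m₁ m₂ A) ≤ x := by
  rw [advantage, fixedGame_toReal, expect_sub_half]
  exact abs_expect_le_of_forall _ fun r =>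
    (fixedStrategy_costLE m₁ m₂ A r).exists_gameBounds hS

theorem advantage_cpaGame_le (hS : S.card < P.parties) (A : P.Adversary S) :
    ∃ x ∈ gameBounds P A.cost, advantage (P.cpaGame S A) ≤ x := by
  rw [advantage, cpaGame_toReal]
  simp only [expect_sub_half]
  exact abs_expect_le_of_forall _ fun r₁ => abs_expect_le_of_forall _ fun r₂ =>
    (A.strategy_costLE r₁ r₂).exists_gameBounds hS

/-! ### Asymptotics -/

namespace PolyBounded

variable {f g : ℕ → ℕ}

theorem mono (hg : PolyBounded g) (h : ∀ κ, f κ ≤ g κ) : PolyBounded f := by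
  obtain ⟨p, hp⟩ := hg
  exact ⟨p, fun κ => (h κ).trans (hp κ)⟩

theorem const (c : ℕ) : PolyBounded fun _ => c := ⟨Polynomial.C c, fun κ => by simp⟩

theorem add (hf : PolyBounded f) (hg : PolyBounded g) : PolyBounded fun κ => f κ + g κ := by
  obtain ⟨p, hp⟩ := hf
  obtain ⟨q, hq⟩ := hg
  exact ⟨p + q, fun κ => by simpa using add_le_add (hp κ) (hq κ)⟩

theorem mul (hf : PolyBounded f) (hg : PolyBounded g) : PolyBounded fun κ => f κ * g κ := by
  obtain ⟨p, hp⟩ := hf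
  obtain ⟨q, hq⟩ := hg
  exact ⟨p * q, fun κ => by simpa using Nat.mul_le_mul (hp κ) (hq κ)⟩

end PolyBounded

theorem polyBounded_simCost {P : ℕ → Params} (hdim : PolyBounded fun κ => (P κ).dim)
    (hmod : PolyBounded fun κ => (P κ).bitLen) (hparties : PolyBounded fun κ => (P κ).parties)
    {c : ℕ → ℕ} (hc : PolyBounded c) :
    PolyBounded fun κ => Strategy.simCost (P κ) (4 + c κ) := by
  have haff : PolyBounded fun κ => (P κ).affineCost (5 * ((P κ).dim * (P κ).bitLen)) :=
    (PolyBounded.const 2).add (hdim.mul (((PolyBounded.const 5).mul (hdim.mul hmod)).mul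
      (((PolyBounded.const 11).mul hmod).add (.const 1))))
  exact ((((PolyBounded.const 4).add ((PolyBounded.const 3).mul hparties)).mul haff).add
    ((PolyBounded.const 2).mul ((PolyBounded.const 4).add hc))).add (.const 2)

theorem negligible_of_gameBounds {P : ℕ → Params} (hdim : PolyBounded fun κ => (P κ).dim)
    (hmod : PolyBounded fun κ => (P κ).bitLen) (hparties : PolyBounded fun κ => (P κ).parties)
    (hkey : RLWEHard (fun κ => (P κ).toRingParams)
      (fun κ => (P κ).keyDist) (fun κ => (P κ).errDist) 1)
    (henc : RLWEHard (fun κ => (P κ).toRingParams)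
      (fun κ => (P κ).encDist) (fun κ => (P κ).errDist) 2)
    {c : ℕ → ℕ} (hc : PolyBounded c) {a : ℕ → ℝ} (ha0 : ∀ κ, 0 ≤ a κ)
    (ha : ∀ κ, ∃ x ∈ gameBounds (P κ) (c κ), a κ ≤ x) : Negligible a := by
  -- The bounds hold separately for each `κ`; choosing a distinguisher for every `κ` yields two
  -- non-uniform families, to which the hardness assumptions apply.
  choose x hx hax using ha
  choose t ht t' ht' hxt using hx
  choose D hD hDt using ht
  choose D' hD' hDt' using ht'
  have hK := polyBounded_simCost hdim hmod hparties hc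
  refine ((hkey D (hK.mono hD)).add (henc D' (hK.mono hD'))).trans_abs_le fun κ => ?_
  simp only [Pi.add_apply, ← hDt, ← hDt', ← hxt]
  rw [abs_of_nonneg (ha0 κ)]
  exact (hax κ).trans (le_abs_self _)

end MPHE

end

theorem theorem1 (P : ℕ → MPHE.Params)
    (hdim : MPHE.PolyBounded fun κ => (P κ).dim)
    (hmod : MPHE.PolyBounded fun κ => (P κ).bitLen)
    (hparties : MPHE.PolyBounded fun κ => (P κ).parties)
    (hkey : MPHE.RLWEHard (fun κ => (P κ).toRingParams)
      (fun κ => (P κ).keyDist) (fun κ => (P κ).errDist) 1)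
    (henc : MPHE.RLWEHard (fun κ => (P κ).toRingParams)
      (fun κ => (P κ).encDist) (fun κ => (P κ).errDist) 2)
    (S : ∀ κ, Finset (Fin (P κ).parties))
    (hS : ∀ κ, (S κ).card < (P κ).parties) :
    (∀ (m₁ m₂ : ∀ κ, (P κ).Rq)
        (A : ∀ κ, MPHE.Circuit ((MPHE.ViewIdx (S κ) ⊕ Fin 2) × (P κ).Pos) Unit),
      MPHE.PolyBounded (fun κ => (A κ).cost) →
        MPHE.Negligible fun κ => MPHE.advantage ((P κ).fixedGame (S κ) (m₁ κ) (m₂ κ) (A κ))) ∧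
    (∀ A : ∀ κ, (P κ).Adversary (S κ),
      MPHE.PolyBounded (fun κ => (A κ).cost) →
        MPHE.Negligible fun κ => MPHE.advantage ((P κ).cpaGame (S κ) (A κ))) :=
  ⟨fun m₁ m₂ A hA => MPHE.negligible_of_gameBounds hdim hmod hparties hkey henc hA
    (fun _ => abs_nonneg _) fun κ => MPHE.advantage_fixedGame_le (hS κ) (m₁ κ) (m₂ κ) (A κ),
  fun A hA => MPHE.negligible_of_gameBounds hdim hmod hparties hkey henc hA
    (fun _ => abs_nonneg _) fun κ => MPHE.advantage_cpaGame_le (hS κ) (A κ)⟩
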